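/- All graphs are finite and simple. A graph is planar if it can be drawn in the plane with distinct points as vertices and with simple arcs joining their ends as edges, such that an edge contains no vertex except its ends and two distinct edges meet only in common ends. A graph is polyhedral if it is planar and $3$-connected, i.e. it has more than $3$ vertices and removing fewer than $3$ vertices always leaves a connected graph. The lexicographic product $A\circ B$ has vertex set $V(A)\times V(B)$, and $(a_1,b_1)$, $(a_2,b_2)$ are adjacent if and only if $a_1a_2\in E(A)$, or $a_1=a_2$ and $b_1b_2\in E(B)$. Proposition. Let $A$ be a graph with at least one edge and $B$ a graph with at least two vertices. Then $A\circ B$ is planar if and only if one of the following holds: (i) $B\simeq\overline{K_2}$ and every connected component of $A$ is either a triangle or a tree; (ii) $B\simeq K_2$ and every connected component of $A$ is a tree. Furthermore, $A\circ B$ is polyhedral if and only if either $A\simeq K_2$ and $B\simeq K_2$, or $A\simeq K_3$ and $B\simeq\overline{K_2}$. Moreover $K_2\circ K_2\simeq K_4$ is the tetrahedron, and $K_3\circ\overline{K_2}$ is isomorphic to the graph of the octahedron. Thus these two graphs are the only polyhedral lexicographic products with such factors. -/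

import Mathlib

namespace SimpleGraph

/-- The lexicographic product `A ∘ B` on `V × W`: `(a₁, b₁)` and `(a₂, b₂)` are adjacent iff
`a₁a₂` is an edge of `A`, or `a₁ = a₂` and `b₁b₂` is an edge of `B`. -/
def lexProd {V W : Type*} (A : SimpleGraph V) (B : SimpleGraph W) : SimpleGraph (V × W) where
  Adj p q := (p.1 = q.1 ∧ B.Adj p.2 q.2) ∨ A.Adj p.1 q.1
  symm := ⟨fun _ _ h => h.imp (fun h => ⟨h.1.symm, h.2.symm⟩) (fun h => h.symm)⟩
  loopless := ⟨fun _ h => h.elim (fun h => B.irrefl h.2) (fun h => A.irrefl h)⟩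

/-- A drawing of `G` in the plane without crossings: vertices are distinct points, every edge is
a simple arc joining its two ends, the only vertices on an edge are its ends, and two different
edges meet only in common ends. -/
structure PlaneDrawing {V : Type*} (G : SimpleGraph V) where
  /-- The point representing a vertex. -/
  point : V → ℝ × ℝ
  /-- The point set representing an edge (irrelevant for pairs that are not edges). -/
  arc : Sym2 V → Set (ℝ × ℝ)
  point_injective : Function.Injective point
  isArc : ∀ u v : V, G.Adj u v →
    ∃ γ : _root_.Path (point u) (point v), Function.Injective γ ∧ Set.range γ = arc s(u, v)
  vertex_mem : ∀ e ∈ G.edgeSet, ∀ w : V, point w ∈ arc e → w ∈ e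
  arc_inter : ∀ e ∈ G.edgeSet, ∀ f ∈ G.edgeSet, e ≠ f → ∀ x ∈ arc e, x ∈ arc f →
    ∃ w : V, w ∈ e ∧ w ∈ f ∧ x = point w

/-- A graph is planar if it can be drawn in the plane without crossings. -/
def IsPlanar {V : Type*} (G : SimpleGraph V) : Prop := Nonempty G.PlaneDrawing

/-- `G` is `k`-connected: it has more than `k` vertices, and removing fewer than `k` vertices
always leaves a connected graph. -/
def IsVertexConnected {V : Type*} (G : SimpleGraph V) (k : ℕ) : Prop :=
  (k : ℕ∞) < ENat.card V ∧
    ∀ S : Finset V, S.card < k → (G.induce {v : V | v ∉ S}).Connected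

/-- A polyhedral graph: planar and `3`-connected. -/
def IsPolyhedral {V : Type*} (G : SimpleGraph V) : Prop :=
  G.IsPlanar ∧ G.IsVertexConnected 3

/-- The graph of the octahedron with vertices `± eᵢ` in three-space, where `(i, ε)` stands for
`ε eᵢ`: two distinct vertices are adjacent iff they are not antipodal. -/
def octahedronGraph : SimpleGraph (Fin 3 × ℤˣ) where
  Adj p q := p ≠ q ∧ q ≠ (p.1, -p.2)
  symm := ⟨fun p q h => ⟨h.1.symm, fun h' => h.2 (by rw [h']; simp)⟩⟩
  loopless := ⟨fun _ h => h.1 rfl⟩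

end SimpleGraph

/-!
The proof rests on one obstruction to planarity, `K₃,₃`, and on one way of drawing graphs, the
two-page book embedding.

**`K₃,₃` is not planar.** For disjoint edges `e`, `f` of a drawing in `ℂ`, the difference of a point
of `e` and a point of `f` never vanishes, so it has a continuous logarithm on a square, whose changes
along the four sides add up to zero (`IsLogChange.add_eq_add`). A side of this square fixes one
point at a vertex and moves the other along an edge. Summed over the 18 pairs of disjoint edges of
`K₃,₃`, every such change occurs twice or cancels; after division by two and exponentiation, the
resulting relation reads `-P = P` for a product `P ≠ 0` of squares of ratios
of vertex differences (`not_forall_disjoint_range_complex`). Only disjointness of images of disjoint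
edges is used, so no general position or Jordan curve theorem is needed, and edges may be replaced
by walks: a planar graph contains no subdivision of `K₃,₃`
(`SimpleGraph.IsPlanar.not_forall_disjoint_support`).

**Necessity.** If `B` has three vertices, an edge of `A` yields `K₃,₃` in `A ∘ B`. If `B` has two
vertices, a subdivision of `K₃,₃` arises from a cycle of length at least four in `A`, from a triangle
with a further edge at one of its vertices, and from a triangle if `B` has an edge. Hence a connected
`A` with `A ∘ B` planar is a triangle or a tree.

**Sufficiency.** If the vertices lie on a line and the edges are distributed to two half-planes
without crossings, parabolic arcs give a drawing (`SimpleGraph.BookEmbedding.isPlanar`). For a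
forest `A`, the vertices are represented by a laminar family of intervals in which every edge joins
an interval to its parent, and the ends of the intervals are the vertices of `A ∘ K₂`
(`SimpleGraph.IsAcyclic.nonempty_bookEmbedding_lexProd_top`). The octahedron has an explicit
embedding, and embeddings of the components are put side by side.

**Polyhedral products.** If `A ∘ B` is `3`-connected, then `A` is connected, so it is a triangle or a
tree. In a tree, removing both copies of the neighbour of a leaf disconnects `A ∘ B`, except when
`A` and `B` are both `K₂`.
-/

/-! ### Changes of the logarithm, and `K₃,₃` in the plane -/

/-- `d` is the total change over `[0, 1]` of a continuous logarithm of `f`. -/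
def IsLogChange (f : ℝ → ℂ) (d : ℂ) : Prop :=
  ∃ L : ℝ → ℂ, Continuous L ∧ (∀ t, Complex.exp (L t) = f t) ∧ d = L 1 - L 0

/-- Lifting along the covering `exp : ℂ → ℂ ∖ {0}`. -/
theorem exists_continuous_complex_log {A : Type*} [TopologicalSpace A] [SimplyConnectedSpace A]
    [LocallyPathConnectedSpace A] (a₀ : A) (F : C(A, ℂ)) (hF : ∀ a, F a ≠ 0) :
    ∃ L : C(A, ℂ), ∀ a, Complex.exp (L a) = F a := by
  obtain ⟨L, hL, -⟩ := Complex.isCoveringMapOn_exp.existsUnique_continuousMap_lifts F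
    (a₀ := a₀) (Complex.exp_log (hF _)) hF
  exact ⟨L, fun a => congrFun hL.2 a⟩

theorem exists_isLogChange {f : ℝ → ℂ} (hf : Continuous f) (h0 : ∀ t, f t ≠ 0) :
    ∃ d, IsLogChange f d := by
  obtain ⟨L, hL⟩ := exists_continuous_complex_log 0 ⟨f, hf⟩ h0
  exact ⟨_, L, L.continuous, hL, rfl⟩

theorem IsLogChange.eq {f : ℝ → ℂ} {d d' : ℂ} (h : IsLogChange f d) (h' : IsLogChange f d') :
    d = d' := by
  obtain ⟨L, hL, hLf, rfl⟩ := h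
  obtain ⟨M, hM, hMf, rfl⟩ := h'
  have hf : Continuous f := by
    rw [← funext hLf]; fun_prop
  have h0 : ∀ t, f t ≠ 0 := fun t => hLf t ▸ Complex.exp_ne_zero _
  have hu := Complex.isCoveringMapOn_exp.existsUnique_continuousMap_lifts (⟨f, hf⟩ : C(ℝ, ℂ))
    (a₀ := 0) (e₀ := L 0) (hLf 0) h0
  -- after adding the constant `L 0 - M 0`, both logarithms agree at `0`, hence everywhere
  have key := hu.unique (y₁ := ⟨L, hL⟩) (y₂ := ⟨fun t => M t + (L 0 - M 0), by fun_prop⟩)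
    ⟨rfl, funext hLf⟩ ⟨by simp, funext fun t => by
      simp [Complex.exp_add, Complex.exp_sub, hLf, hMf, h0]⟩
  have := congrArg (fun F : C(ℝ, ℂ) => F 1) key
  simp only [ContinuousMap.coe_mk] at this
  linear_combination this

theorem IsLogChange.neg {f : ℝ → ℂ} {d : ℂ} (h : IsLogChange f d) :
    IsLogChange (fun t => -f t) d := by
  obtain ⟨L, hL, hLf, rfl⟩ := h
  refine ⟨fun t => L t + Real.pi * Complex.I, by fun_prop, fun t => ?_, by ring⟩
  rw [Complex.exp_add, hLf, Complex.exp_pi_mul_I]; ring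

theorem IsLogChange.exp_eq {f : ℝ → ℂ} {d : ℂ} (h : IsLogChange f d) :
    Complex.exp d = f 1 / f 0 := by
  obtain ⟨L, -, hLf, rfl⟩ := h
  rw [Complex.exp_sub, hLf, hLf]

/-- The logarithm of `γ s - δ t` exists on the whole square, so its changes along the four sides
of the square add up to zero. -/
theorem IsLogChange.add_eq_add {γ δ : ℝ → ℂ} (hγ : Continuous γ) (hδ : Continuous δ)
    (h : ∀ s t, γ s ≠ δ t) {d₁ d₂ d₃ d₄ : ℂ}
    (h₁ : IsLogChange (fun s => γ s - δ 0) d₁) (h₂ : IsLogChange (fun t => δ t - γ 1) d₂)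
    (h₃ : IsLogChange (fun s => γ s - δ 1) d₃) (h₄ : IsLogChange (fun t => δ t - γ 0) d₄) :
    d₁ + d₂ = d₃ + d₄ := by
  obtain ⟨L, hL⟩ := exists_continuous_complex_log ((0, 0) : ℝ × ℝ)
    ⟨fun p => γ p.1 - δ p.2, by fun_prop⟩ fun p => sub_ne_zero.2 (h _ _)
  simp only [ContinuousMap.coe_mk, Prod.forall] at hL
  have e₁ := h₁.eq ⟨fun s => L (s, 0), by fun_prop, fun s => hL s 0, rfl⟩
  have e₃ := h₃.eq ⟨fun s => L (s, 1), by fun_prop, fun s => hL s 1, rfl⟩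
  have e₂ := h₂.neg.eq ⟨fun t => L (1, t), by fun_prop, fun t => by rw [hL]; ring, rfl⟩
  have e₄ := h₄.neg.eq ⟨fun t => L (0, t), by fun_prop, fun t => by rw [hL]; ring, rfl⟩
  rw [e₁, e₂, e₃, e₄]
  ring

/-- In every continuous map of `K₃,₃` to the plane, some two edges without a common end have
intersecting images. -/
theorem not_forall_disjoint_range_complex (x y : Fin 3 → ℂ) (γ : ∀ i j, Path (x i) (y j))
    (hγ : ∀ i i' j j', i ≠ i' → j ≠ j' → Disjoint (Set.range (γ i j)) (Set.range (γ i' j'))) :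
    False := by
  set g : Fin 3 → Fin 3 → ℝ → ℂ := fun i j => (γ i j).extend with hg
  have gc : ∀ i j, Continuous (g i j) := fun i j => (γ i j).continuous_extend
  have g0 : ∀ i j, g i j 0 = x i := fun i j => (γ i j).extend_zero
  have g1 : ∀ i j, g i j 1 = y j := fun i j => (γ i j).extend_one
  have gd : ∀ i i' j j', i ≠ i' → j ≠ j' → ∀ s t, g i j s ≠ g i' j' t := by
    intro i i' j j' hi hj s t
    refine (hγ i i' j j' hi hj).ne_of_mem ?_ ?_ <;>
      rw [← Path.extend_range] <;> exact Set.mem_range_self _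
  have gx : ∀ i' i j, i ≠ i' → ∀ s, g i j s - x i' ≠ 0 := by
    intro i' i j hi s
    obtain ⟨j', hj'⟩ := exists_ne j
    rw [← g0 i' j']
    exact sub_ne_zero.2 (gd _ _ _ _ hi hj'.symm _ _)
  have gy : ∀ j' i j, j ≠ j' → ∀ s, g i j s - y j' ≠ 0 := by
    intro j' i j hj s
    obtain ⟨i', hi'⟩ := exists_ne i
    rw [← g1 i' j']
    exact sub_ne_zero.2 (gd _ _ _ _ hi'.symm hj _ _)
  have hD : ∀ i' i j, ∃ d, i ≠ i' → IsLogChange (fun s => g i j s - x i') d := by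
    intro i' i j
    by_cases hi : i = i'
    · exact ⟨0, fun h => absurd hi h⟩
    · obtain ⟨d, hd⟩ := exists_isLogChange ((gc i j).sub continuous_const) (gx i' i j hi)
      exact ⟨d, fun _ => hd⟩
  have hE : ∀ j' i j, ∃ d, j ≠ j' → IsLogChange (fun s => g i j s - y j') d := by
    intro j' i j
    by_cases hj : j = j'
    · exact ⟨0, fun h => absurd hj h⟩
    · obtain ⟨d, hd⟩ := exists_isLogChange ((gc i j).sub continuous_const) (gy j' i j hj)
      exact ⟨d, fun _ => hd⟩
  choose D hD using hD
  choose E hE using hE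
  have rel : ∀ i i' j j', i ≠ i' → j ≠ j' →
      D i' i j + E j i' j' = E j' i j + D i i' j' := by
    intro i i' j j' hi hj
    refine IsLogChange.add_eq_add (gc i j) (gc i' j') (gd _ _ _ _ hi hj) ?_ ?_ ?_ ?_
    · rw [g0]; exact hD _ _ _ hi
    · rw [g1]; exact hE _ _ _ hj.symm
    · rw [g1]; exact hE _ _ _ hj
    · rw [g0]; exact hD _ _ _ hi.symm
  have xne : ∀ i i', i ≠ i' → x i - x i' ≠ 0 := fun i i' hi => by
    simpa [g0] using gx i' i 0 hi 0
  have yxne : ∀ i j, y j - x i ≠ 0 := fun i j => by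
    obtain ⟨i', hi'⟩ := exists_ne i
    simpa [g1] using gx i i' j hi' 1
  have yne : ∀ j j', j ≠ j' → y j - y j' ≠ 0 := fun j j' hj => by
    simpa [g1] using gy j' 0 j hj 1
  have expD : ∀ i' i j, i ≠ i' → Complex.exp (D i' i j) = (y j - x i') / (x i - x i') := by
    intro i' i j hi
    simpa only [g0, g1] using (hD _ _ _ hi).exp_eq
  have expE : ∀ j' i j, j ≠ j' → Complex.exp (E j' i j) = (y j - y j') / (x i - y j') := by
    intro j' i j hj
    simpa only [g0, g1] using (hE _ _ _ hj).exp_eq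
  -- `S j` collects the changes, along the edges at `y j`, as seen from the `x i`;
  -- `T j'` collects the changes, along the edges at `x 0` and `x 2`, as seen from `y j'`
  set S : Fin 3 → ℂ := fun j => D 1 0 j - D 0 1 j + (D 2 0 j - D 0 2 j) + (D 2 1 j - D 1 2 j)
    with hS
  set T : Fin 3 → Fin 3 → Fin 3 → ℂ := fun j' j k => E j' 0 j - E j' 2 j + (E j' 0 k - E j' 2 k)
    with hT
  have expS : ∀ j, Complex.exp (S j) = -((y j - x 2) / (y j - x 0)) ^ 2 := by
    intro j
    have h10 := xne 1 0 (by decide)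
    have h20 := xne 2 0 (by decide)
    have h21 := xne 2 1 (by decide)
    have h01 := xne 0 1 (by decide)
    have h02 := xne 0 2 (by decide)
    have h12 := xne 1 2 (by decide)
    have y0 := yxne 0 j
    have y1 := yxne 1 j
    have y2 := yxne 2 j
    simp only [hS, Complex.exp_add, Complex.exp_sub]
    rw [expD _ _ _ (by decide), expD _ _ _ (by decide), expD _ _ _ (by decide),
      expD _ _ _ (by decide), expD _ _ _ (by decide), expD _ _ _ (by decide),
      ← neg_sub (x 1) (x 0), ← neg_sub (x 2) (x 0), ← neg_sub (x 2) (x 1)]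
    field_simp
  have expT : ∀ j' j k, j ≠ j' → k ≠ j' →
      Complex.exp (T j' j k) = ((y j' - x 2) / (y j' - x 0)) ^ 2 := by
    intro j' j k hj hk
    have y0 := yxne 0 j'
    have y2 := yxne 2 j'
    have n1 := yne _ _ hj
    have n2 := yne _ _ hk
    simp only [hT, Complex.exp_add, Complex.exp_sub]
    rw [expE _ _ _ hj, expE _ _ _ hj, expE _ _ _ hk, expE _ _ _ hk,
      ← neg_sub (y j') (x 0), ← neg_sub (y j') (x 2)]
    field_simp
  -- in the sum of the relations over all pairs of disjoint edges, the changes along the edges at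
  -- `x 1` as seen from the `y j` cancel, and all other changes occur twice
  have sum : S 0 + S 1 + S 2 = T 0 1 2 + T 1 0 2 + T 2 0 1 := by
    simp only [hS, hT]
    linear_combination (1 / 2) * (
      rel 0 1 0 1 (by decide) (by decide) + rel 0 1 1 0 (by decide) (by decide) +
      rel 0 1 0 2 (by decide) (by decide) + rel 0 1 2 0 (by decide) (by decide) +
      rel 0 1 1 2 (by decide) (by decide) + rel 0 1 2 1 (by decide) (by decide) +
      rel 0 2 0 1 (by decide) (by decide) + rel 0 2 1 0 (by decide) (by decide) +
      rel 0 2 0 2 (by decide) (by decide) + rel 0 2 2 0 (by decide) (by decide) +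
      rel 0 2 1 2 (by decide) (by decide) + rel 0 2 2 1 (by decide) (by decide) +
      rel 1 2 0 1 (by decide) (by decide) + rel 1 2 1 0 (by decide) (by decide) +
      rel 1 2 0 2 (by decide) (by decide) + rel 1 2 2 0 (by decide) (by decide) +
      rel 1 2 1 2 (by decide) (by decide) + rel 1 2 2 1 (by decide) (by decide))
  have key := congrArg Complex.exp sum
  simp only [Complex.exp_add] at key
  rw [expS, expS, expS, expT _ _ _ (by decide) (by decide), expT _ _ _ (by decide) (by decide),
    expT _ _ _ (by decide) (by decide)] at key
  have ne : ∀ j, ((y j - x 2) / (y j - x 0)) ^ 2 ≠ 0 := fun j =>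
    pow_ne_zero _ (div_ne_zero (yxne _ _) (yxne _ _))
  have : (2 : ℂ) * (((y 0 - x 2) / (y 0 - x 0)) ^ 2 * ((y 1 - x 2) / (y 1 - x 0)) ^ 2 *
      ((y 2 - x 2) / (y 2 - x 0)) ^ 2) = 0 := by linear_combination -key
  simp [ne, -ne_eq, -div_eq_zero_iff] at this


theorem not_forall_disjoint_range (x y : Fin 3 → ℝ × ℝ) (γ : ∀ i j, Path (x i) (y j))
    (hγ : ∀ i i' j j', i ≠ i' → j ≠ j' → Disjoint (Set.range (γ i j)) (Set.range (γ i' j'))) :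
    False := by
  let e := Complex.equivRealProdCLM.symm
  refine not_forall_disjoint_range_complex _ _ (fun i j => (γ i j).map e.continuous) ?_
  intro i i' j j' hi hj
  simp only [Path.map_coe, Set.range_comp]
  exact (Set.disjoint_image_iff e.injective).2 (hγ _ _ _ _ hi hj)

/-! ### Subdivisions of `K₃,₃` in planar graphs and in lexicographic products -/

namespace SimpleGraph

variable {V W : Type*} {G : SimpleGraph V}

/-- Consecutive arcs along a walk are concatenated to a curve. -/
theorem PlaneDrawing.exists_path_of_walk (d : G.PlaneDrawing) {u v : V} (w : G.Walk u v) :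
    ∃ γ : _root_.Path (d.point u) (d.point v), ∀ x ∈ Set.range γ,
      (∃ z ∈ w.support, x = d.point z) ∨ ∃ e ∈ w.edges, x ∈ d.arc e := by
  induction w with
  | nil => exact ⟨_root_.Path.refl _, by rintro _ ⟨t, rfl⟩; simp⟩
  | @cons a b c h w ih =>
    obtain ⟨γ, hγ⟩ := ih
    obtain ⟨δ, -, hδ⟩ := d.isArc _ _ h
    refine ⟨δ.trans γ, fun x hx => ?_⟩
    rw [Path.trans_range, hδ] at hx
    rcases hx with hx | hx
    · exact Or.inr ⟨s(a, b), by simp, hx⟩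
    · rcases hγ x hx with ⟨z, hz, rfl⟩ | ⟨e, he, hx⟩
      · exact Or.inl ⟨z, by simp [hz], rfl⟩
      · exact Or.inr ⟨e, by simp [he], hx⟩

/-- A planar graph contains no subdivision of `K₃,₃`. The branch walks may intersect each other or
themselves as long as walks without a common end are disjoint. -/
theorem IsPlanar.not_forall_disjoint_support (hG : G.IsPlanar) (x y : Fin 3 → V)
    (w : ∀ i j, G.Walk (x i) (y j))
    (hw : ∀ i i' j j', i ≠ i' → j ≠ j' → ∀ z ∈ (w i j).support, z ∉ (w i' j').support) :
    False := by
  obtain ⟨d⟩ := hG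
  choose γ hγ using fun i j => d.exists_path_of_walk (w i j)
  refine not_forall_disjoint_range _ _ γ fun i i' j j' hi hj => ?_
  have hd := hw i i' j j' hi hj
  rw [Set.disjoint_left]
  intro p hp hp'
  have hmem : ∀ {u v : V} (w : G.Walk u v) {e : Sym2 V} {z : V}, e ∈ w.edges → z ∈ e →
      z ∈ w.support := by
    intro u v w e z he hz
    exact w.mem_support_of_mem_edges he hz
  rcases hγ i j p hp with ⟨z, hz, rfl⟩ | ⟨e, he, hpe⟩ <;>
    rcases hγ i' j' _ hp' with ⟨z', hz', hzz⟩ | ⟨f, hf, hpf⟩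
  · exact hd z hz (d.point_injective hzz ▸ hz')
  · exact hd z hz (hmem _ hf (d.vertex_mem f (Walk.edges_subset_edgeSet _ hf) z hpf))
  · subst hzz
    exact hd z' (hmem _ he (d.vertex_mem e (Walk.edges_subset_edgeSet _ he) z' hpe)) hz'
  · have hef : e ≠ f := by
      rintro rfl
      induction e with | _ a b => exact hd a (hmem _ he (by simp)) (hmem _ hf (by simp))
    obtain ⟨z, hze, hzf, -⟩ := d.arc_inter e (Walk.edges_subset_edgeSet _ he) f
      (Walk.edges_subset_edgeSet _ hf) hef p hpe hpf
    exact hd z (hmem _ he hze) (hmem _ hf hzf)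

theorem IsPlanar.of_hom {H : SimpleGraph W} (f : G →g H) (hf : Function.Injective f)
    (hH : H.IsPlanar) : G.IsPlanar := by
  obtain ⟨d⟩ := hH
  refine ⟨⟨d.point ∘ f, fun e => d.arc (e.map f), d.point_injective.comp hf,
    fun u v h => d.isArc _ _ (f.map_adj h), fun e he w hw => ?_, fun e he e' he' hne x hx hx' => ?_⟩⟩
  · have := d.vertex_mem _ (f.map_mem_edgeSet he) _ hw
    obtain ⟨z, hz, hzw⟩ := Sym2.mem_map.1 this
    exact hf hzw ▸ hz
  · obtain ⟨w, hw, hw', rfl⟩ := d.arc_inter _ (f.map_mem_edgeSet he) _ (f.map_mem_edgeSet he')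
      (fun h => hne (Sym2.map.injective hf h)) x hx hx'
    obtain ⟨z, hz, rfl⟩ := Sym2.mem_map.1 hw
    obtain ⟨z', hz', hzz⟩ := Sym2.mem_map.1 hw'
    exact ⟨z, hz, hf hzz ▸ hz', rfl⟩

theorem IsPlanar.not_forall_adj (hG : G.IsPlanar) (x y : Fin 3 → V)
    (hx : Function.Injective x) (hy : Function.Injective y) (h : ∀ i j, G.Adj (x i) (y j)) :
    False := by
  refine hG.not_forall_disjoint_support x y (fun i j => (h i j).toWalk) ?_
  intro i i' j j' hi hj z hz hz'
  have h1 := hx.ne hi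
  have h2 := hy.ne hj
  have h3 := (h i j').ne
  have h4 := (h i' j).ne
  simp at hz hz'
  grind

variable {A : SimpleGraph V} {B : SimpleGraph W}

/-- A walk in `A` between distinct vertices lifts to `A ∘ B` with an arbitrary second coordinate at its
first vertex and a common second coordinate elsewhere. -/
theorem exists_walk_lexProd {u v : V} (q : A.Walk u v) (h : u ≠ v) (b c : W) :
    ∃ p : (A.lexProd B).Walk (u, b) (v, c),
      ∀ z ∈ p.support, z = (u, b) ∨ z.2 = c ∧ z.1 ∈ q.support := by
  have lift : ∀ {u v : V} (q : A.Walk u v), ∃ p : (A.lexProd B).Walk (u, c) (v, c),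
      ∀ z ∈ p.support, z.2 = c ∧ z.1 ∈ q.support := by
    intro u v q
    induction q with
    | nil => exact ⟨.nil, by simp⟩
    | cons h q ih =>
      obtain ⟨p, hp⟩ := ih
      exact ⟨.cons (Or.inr h) p, by simp; grind⟩
  cases q with
  | nil => exact absurd rfl h
  | cons h q =>
    obtain ⟨p, hp⟩ := lift q
    exact ⟨.cons (Or.inr h) p, by simp; grind⟩

/-- `A ∘ B` is not planar if `A` has a cycle `v₀ v₁ v₂ v₃ … v₀` of length at least four: the sets
`{(v₀, b), (v₀, c), (v₂, b)}` and `{(v₁, b), (v₁, c), (v₃, b)}` span a subdivision of `K₃,₃`. -/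
theorem not_isPlanar_lexProd_of_walk {b c : W} (hbc : b ≠ c) {v₀ v₁ v₂ v₃ : V}
    (h₀₁ : A.Adj v₀ v₁) (h₁₂ : A.Adj v₁ v₂) (h₂₃ : A.Adj v₂ v₃) (h₀₂ : v₀ ≠ v₂) (h₃₀ : v₃ ≠ v₀)
    (q : A.Walk v₃ v₀) (hq₁ : v₁ ∉ q.support) (hq₂ : v₂ ∉ q.support) :
    ¬ (A.lexProd B).IsPlanar := by
  intro hG
  have h₁₃ : v₁ ≠ v₃ := fun h => hq₁ (h ▸ q.start_mem_support)
  obtain ⟨p, hp⟩ := exists_walk_lexProd (B := B) q h₃₀ b b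
  obtain ⟨p', hp'⟩ := exists_walk_lexProd (B := B) q h₃₀ b c
  have adj : ∀ {u v : V} (b c : W), A.Adj u v → (A.lexProd B).Adj (u, b) (v, c) :=
    fun _ _ h => Or.inr h
  have n1 := h₀₁.ne
  have n2 := h₁₂.ne
  have n3 := h₂₃.ne
  have hw : ∀ i j : Fin 3, ∃ w : (A.lexProd B).Walk
      ((![(v₀, b), (v₀, c), (v₂, b)] : Fin 3 → V × W) i)
      ((![(v₁, b), (v₁, c), (v₃, b)] : Fin 3 → V × W) j), ∀ z ∈ w.support,
        z = (![(v₀, b), (v₀, c), (v₂, b)] : Fin 3 → V × W) i ∨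
        z = (![(v₁, b), (v₁, c), (v₃, b)] : Fin 3 → V × W) j ∨
        (j = 2 ∧ z.1 ∈ q.support ∧ (i = 0 ∧ z.2 = b ∨ i = 1 ∧ z.2 = c)) := by
    intro i j
    fin_cases i <;> fin_cases j
    · exact ⟨(adj b b h₀₁).toWalk, by simp⟩
    · exact ⟨(adj b c h₀₁).toWalk, by simp⟩
    · exact ⟨p.reverse, by simp; grind⟩
    · exact ⟨(adj c b h₀₁).toWalk, by simp⟩
    · exact ⟨(adj c c h₀₁).toWalk, by simp⟩
    · exact ⟨p'.reverse, by simp; grind⟩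
    · exact ⟨(adj b b h₁₂.symm).toWalk, by simp⟩
    · exact ⟨(adj b c h₁₂.symm).toWalk, by simp⟩
    · exact ⟨(adj b b h₂₃).toWalk, by simp⟩
  choose w hw using hw
  refine hG.not_forall_disjoint_support _ _ w fun i i' j j' hi hj z hz hz' => ?_
  have := hw i j z hz
  have := hw i' j' z hz'
  clear hw hz hz' w adj hp hp' p p'
  obtain ⟨z₁, z₂⟩ := z
  fin_cases i <;> fin_cases i' <;> first | exact absurd rfl hi | skip
  all_goals
    fin_cases j <;> fin_cases j' <;> first | exact absurd rfl hj | skip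
  all_goals
    simp at *; grind

/-- `A ∘ B` is not planar if `A` has a triangle `uvw` with a further edge `ux`: the sets
`{(v, b), (v, c), (u, b)}` and `{(w, b), (w, c), (u, c)}` span a subdivision of `K₃,₃`, in which
`(u, b)` and `(u, c)` are joined through `(x, b)`. -/
theorem not_isPlanar_lexProd_of_triangle {b c : W} (hbc : b ≠ c) {u v w x : V}
    (huv : A.Adj u v) (huw : A.Adj u w) (hvw : A.Adj v w) (hux : A.Adj u x) (hxv : x ≠ v)
    (hxw : x ≠ w) : ¬ (A.lexProd B).IsPlanar := by
  intro hG
  have adj : ∀ {u v : V} (b c : W), A.Adj u v → (A.lexProd B).Adj (u, b) (v, c) :=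
    fun _ _ h => Or.inr h
  have n1 := huv.ne
  have n2 := huw.ne
  have n3 := hvw.ne
  have n4 := hux.ne
  have hw : ∀ i j : Fin 3, ∃ p : (A.lexProd B).Walk
      ((![(v, b), (v, c), (u, b)] : Fin 3 → V × W) i)
      ((![(w, b), (w, c), (u, c)] : Fin 3 → V × W) j), ∀ z ∈ p.support,
        z = (![(v, b), (v, c), (u, b)] : Fin 3 → V × W) i ∨
        z = (![(w, b), (w, c), (u, c)] : Fin 3 → V × W) j ∨ (i = 2 ∧ j = 2 ∧ z = (x, b)) := by
    intro i j
    fin_cases i <;> fin_cases j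
    · exact ⟨(adj b b hvw).toWalk, by simp⟩
    · exact ⟨(adj b c hvw).toWalk, by simp⟩
    · exact ⟨(adj b c huv.symm).toWalk, by simp⟩
    · exact ⟨(adj c b hvw).toWalk, by simp⟩
    · exact ⟨(adj c c hvw).toWalk, by simp⟩
    · exact ⟨(adj c c huv.symm).toWalk, by simp⟩
    · exact ⟨(adj b b huw).toWalk, by simp⟩
    · exact ⟨(adj b c huw).toWalk, by simp⟩
    · exact ⟨.cons (adj b b hux) (adj b c hux.symm).toWalk, by simp⟩
  choose p hp using hw
  refine hG.not_forall_disjoint_support _ _ p fun i i' j j' hi hj z hz hz' => ?_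
  have := hp i j z hz
  have := hp i' j' z hz'
  clear hp hz hz' p adj
  obtain ⟨z₁, z₂⟩ := z
  fin_cases i <;> fin_cases i' <;> first | exact absurd rfl hi | skip
  all_goals
    fin_cases j <;> fin_cases j' <;> first | exact absurd rfl hj | skip
  all_goals
    simp at *; grind

end SimpleGraph

/-! ### Two-page book embeddings -/

namespace SimpleGraph

variable {V W : Type*} {G : SimpleGraph V}

/-- A two-page book embedding: the vertices are placed on a line, and each edge is assigned to one
of two half-planes (pages) bounded by that line, such that edges on the same page do not cross.
`page b u v` is only meaningful if `u` lies to the left of `v`. -/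
structure BookEmbedding (G : SimpleGraph V) where
  pos : V → ℝ
  pos_injective : Function.Injective pos
  page : Bool → V → V → Prop
  exists_page : ∀ u v, G.Adj u v → pos u < pos v → ∃ b, page b u v
  noncrossing : ∀ b u v x y, page b u v → page b x y →
    ¬ (pos u < pos x ∧ pos x < pos v ∧ pos v < pos y)

namespace BookEmbedding

/-- A book embedding restricts along an injective homomorphism. -/
def comap {H : SimpleGraph W} (E : H.BookEmbedding) (f : G →g H) (hf : Function.Injective f) :
    G.BookEmbedding where
  pos := E.pos ∘ f
  pos_injective := E.pos_injective.comp hf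
  page b u v := E.page b (f u) (f v)
  exists_page _ _ h := E.exists_page _ _ (f.map_adj h)
  noncrossing b _ _ _ _ := E.noncrossing b _ _ _ _

/-- Over two intervals with different, non-crossing pairs of ends, the parabolas through the ends
meet only on the axis. -/
theorem parabola_eq_zero {a b c d t : ℝ} (hat : a ≤ t) (htb : t ≤ b) (hct : c ≤ t) (htd : t ≤ d)
    (h : (t - a) * (b - t) = (t - c) * (d - t)) (h₁ : ¬ (a < c ∧ c < b ∧ b < d))
    (h₂ : ¬ (c < a ∧ a < d ∧ d < b)) (hne : ¬ (a = c ∧ b = d)) : (t - a) * (b - t) = 0 := by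
  have nested : ∀ {a b c d : ℝ}, a ≤ t → t ≤ b → c ≤ t → t ≤ d →
      (t - a) * (b - t) = (t - c) * (d - t) → ¬ (a < c ∧ c < b ∧ b < d) → a < c →
      (t - a) * (b - t) = 0 := by
    intro a b c d hat htb hct htd h h₁ hac
    rcases htb.eq_or_lt with rfl | htb'
    · ring
    · have hdb : d ≤ b := not_lt.1 fun hbd => h₁ ⟨hac, hct.trans_lt htb', hbd⟩
      nlinarith [mul_pos (sub_pos.2 hac) (sub_pos.2 htb'),
        mul_nonneg (sub_nonneg.2 hct) (sub_nonneg.2 hdb)]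
  rcases lt_trichotomy a c with hac | rfl | hca
  · exact nested hat htb hct htd h h₁ hac
  · have hbd : b - d ≠ 0 := sub_ne_zero.2 fun hbd => hne ⟨rfl, hbd⟩
    have : (t - a) * (b - d) = 0 := by linear_combination h
    rw [(mul_eq_zero.1 this).resolve_right hbd, zero_mul]
  · rw [h]
    exact nested hct htd hat htb h.symm h₂ hca

variable (E : G.BookEmbedding)

open Classical in
/-- The side of the axis on which an edge is drawn. -/
noncomputable def side (e : Sym2 V) : ℝ :=
  if ∃ u v, e = s(u, v) ∧ E.pos u < E.pos v ∧ E.page true u v then 1 else -1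

theorem side_eq_or (e : Sym2 V) : E.side e = 1 ∨ E.side e = -1 := by
  unfold side; split_ifs <;> simp

theorem exists_page_of_adj {u v : V} (h : G.Adj u v) (huv : E.pos u < E.pos v) :
    ∃ b, E.page b u v ∧ E.side s(u, v) = if b then 1 else -1 := by
  by_cases hp : E.page true u v
  · exact ⟨true, hp, if_pos ⟨u, v, rfl, huv, hp⟩⟩
  · obtain ⟨b, hb⟩ := E.exists_page u v h huv
    cases b
    · refine ⟨false, hb, if_neg ?_⟩
      rintro ⟨u', v', he, huv', hp'⟩
      rcases Sym2.eq_iff.1 he with ⟨rfl, rfl⟩ | ⟨rfl, rfl⟩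
      · exact hp hp'
      · exact lt_asymm huv huv'
    · exact absurd hb hp

/-- The parabolic arc over (or under) the interval between the two ends of an edge. -/
def arc (e : Sym2 V) : Set (ℝ × ℝ) :=
  {q | ∃ u v, e = s(u, v) ∧ E.pos u ≤ q.1 ∧ q.1 ≤ E.pos v ∧
    q.2 = E.side e * ((q.1 - E.pos u) * (E.pos v - q.1))}

theorem mem_arc {u v : V} (h : E.pos u < E.pos v) {q : ℝ × ℝ} :
    q ∈ E.arc s(u, v) ↔ E.pos u ≤ q.1 ∧ q.1 ≤ E.pos v ∧
      q.2 = E.side s(u, v) * ((q.1 - E.pos u) * (E.pos v - q.1)) := by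
  constructor
  · rintro ⟨u', v', he, h1, h2, h3⟩
    rcases Sym2.eq_iff.1 he with ⟨rfl, rfl⟩ | ⟨rfl, rfl⟩
    · exact ⟨h1, h2, h3⟩
    · linarith
  · rintro ⟨h1, h2, h3⟩
    exact ⟨u, v, rfl, h1, h2, h3⟩

theorem isArc_of_lt {u v : V} (h : E.pos u < E.pos v) :
    ∃ γ : _root_.Path ((E.pos u, 0) : ℝ × ℝ) (E.pos v, 0),
      Function.Injective γ ∧ Set.range γ = E.arc s(u, v) := by
  have h' : E.pos v - E.pos u ≠ 0 := (sub_pos.2 h).ne'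
  refine ⟨⟨⟨fun t => (E.pos u + t * (E.pos v - E.pos u),
    E.side s(u, v) * ((t * (1 - t)) * (E.pos v - E.pos u) ^ 2)), by fun_prop⟩, by simp,
    by simp⟩, fun s t hst => ?_, ?_⟩
  · have := congrArg Prod.fst hst
    simp only [Path.coe_mk_mk, add_right_inj, mul_left_inj' h'] at this
    exact Subtype.ext this
  · ext ⟨p, q⟩
    rw [E.mem_arc h]
    constructor
    · rintro ⟨t, ht⟩
      simp only [Path.coe_mk_mk, Prod.mk.injEq] at ht
      obtain ⟨rfl, rfl⟩ := ht
      have h0 := t.2.1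
      have h1 := t.2.2
      refine ⟨by nlinarith, by nlinarith, by ring⟩
    · rintro ⟨h1, h2, h3⟩
      simp only at h1 h2 h3
      refine ⟨⟨(p - E.pos u) / (E.pos v - E.pos u), ?_, ?_⟩, ?_⟩
      · exact div_nonneg (by linarith) (by linarith)
      · rw [div_le_one (by linarith)]; linarith
      · simp only [Path.coe_mk_mk, Prod.mk.injEq]
        rw [h3]
        constructor <;> field_simp <;> ring

theorem exists_lt_of_mem_edgeSet {e : Sym2 V} (he : e ∈ G.edgeSet) :
    ∃ u v, e = s(u, v) ∧ G.Adj u v ∧ E.pos u < E.pos v := by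
  induction e with | _ u v
  rcases (E.pos_injective.ne (G.ne_of_adj he)).lt_or_gt with h | h
  · exact ⟨u, v, rfl, he, h⟩
  · exact ⟨v, u, Sym2.eq_swap, G.adj_symm he, h⟩

/-- A point common to the arcs of two edges lies on the axis. -/
theorem eq_zero_of_mem_arc {u v x y : V} (huv : G.Adj u v) (hxy : G.Adj x y)
    (hlt : E.pos u < E.pos v) (hlt' : E.pos x < E.pos y) (hne : s(u, v) ≠ s(x, y)) {q : ℝ × ℝ}
    (hq : q ∈ E.arc s(u, v)) (hq' : q ∈ E.arc s(x, y)) : q.2 = 0 := by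
  obtain ⟨h1, h2, h3⟩ := (E.mem_arc hlt).1 hq
  obtain ⟨h1', h2', h3'⟩ := (E.mem_arc hlt').1 hq'
  have hP := mul_nonneg (sub_nonneg.2 h1) (sub_nonneg.2 h2)
  have hP' := mul_nonneg (sub_nonneg.2 h1') (sub_nonneg.2 h2')
  obtain ⟨b, hb, hsb⟩ := E.exists_page_of_adj huv hlt
  obtain ⟨c, hc, hsc⟩ := E.exists_page_of_adj hxy hlt'
  rw [hsb] at h3
  rw [hsc] at h3'
  have same : b = c → (q.1 - E.pos u) * (E.pos v - q.1) = (q.1 - E.pos x) * (E.pos y - q.1) →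
      (q.1 - E.pos u) * (E.pos v - q.1) = 0 := by
    rintro rfl h
    refine parabola_eq_zero h1 h2 h1' h2' h (E.noncrossing b _ _ _ _ hb hc)
      (E.noncrossing b _ _ _ _ hc hb) ?_
    rintro ⟨hu, hv⟩
    exact hne (by rw [E.pos_injective hu, E.pos_injective hv])
  cases b <;> cases c <;> simp at h3 h3' same
  · have := same (by linarith); grind
  · linarith
  · linarith
  · have := same (by linarith); grind

theorem exists_of_mem_arc {u v : V} (hlt : E.pos u < E.pos v) {q : ℝ × ℝ}
    (hq : q ∈ E.arc s(u, v)) (h0 : q.2 = 0) : ∃ w ∈ s(u, v), E.pos w = q.1 := by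
  obtain ⟨h1, h2, h3⟩ := (E.mem_arc hlt).1 hq
  have : (q.1 - E.pos u) * (E.pos v - q.1) = 0 := by
    rcases E.side_eq_or s(u, v) with h | h <;> rw [h] at h3 <;> linarith
  rcases mul_eq_zero.1 this with h | h
  · exact ⟨u, by simp, by linarith⟩
  · exact ⟨v, by simp, by linarith⟩

theorem isPlanar (E : G.BookEmbedding) : G.IsPlanar := by
  refine ⟨⟨fun v => (E.pos v, 0), E.arc, fun u v h => E.pos_injective (Prod.ext_iff.1 h).1,
    fun u v h => ?_, fun e he w hw => ?_, fun e he f hf hne q hq hq' => ?_⟩⟩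
  · rcases (E.pos_injective.ne h.ne).lt_or_gt with hlt | hlt
    · exact E.isArc_of_lt hlt
    · obtain ⟨γ, hγ, hr⟩ := E.isArc_of_lt hlt
      refine ⟨γ.symm, hγ.comp unitInterval.symm_bijective.injective, ?_⟩
      rw [Path.symm_range, hr, Sym2.eq_swap]
  · obtain ⟨u, v, rfl, -, hlt⟩ := E.exists_lt_of_mem_edgeSet he
    obtain ⟨z, hz, hzw⟩ := E.exists_of_mem_arc hlt hw rfl
    exact E.pos_injective hzw ▸ hz
  · obtain ⟨u, v, rfl, huv, hlt⟩ := E.exists_lt_of_mem_edgeSet he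
    obtain ⟨x, y, rfl, hxy, hlt'⟩ := E.exists_lt_of_mem_edgeSet hf
    have h0 := E.eq_zero_of_mem_arc huv hxy hlt hlt' hne hq hq'
    obtain ⟨w, hw, hwq⟩ := E.exists_of_mem_arc hlt hq h0
    obtain ⟨w', hw', hwq'⟩ := E.exists_of_mem_arc hlt' hq' h0
    exact ⟨w, hw, E.pos_injective (hwq.trans hwq'.symm) ▸ hw', Prod.ext hwq.symm h0⟩

/-- Book embeddings of the parts of a disjoint union are placed side by side. -/
theorem nonempty_of_fibers [Finite V] {ι : Type*} [Finite ι] (f : V → ι)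
    (hf : ∀ u v, G.Adj u v → f u = f v)
    (h : ∀ i, Nonempty (G.induce {v | f v = i}).BookEmbedding) : Nonempty G.BookEmbedding := by
  let E := fun i => (h i).some
  obtain ⟨k, ⟨e⟩⟩ := Finite.exists_equiv_fin ι
  let g : V → ℝ := fun v => (E (f v)).pos ⟨v, rfl⟩
  obtain ⟨M, hM⟩ := (Set.finite_range fun v => |g v|).bddAbove
  have hM : ∀ v, |g v| ≤ M := fun v => hM ⟨v, rfl⟩
  let p : V → ℝ := fun v => (2 * M + 1) * ((e (f v) : ℕ) : ℝ) + g v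
  have hlt : ∀ u v, e (f u) < e (f v) → p u < p v := by
    intro u v huv
    have h1 : (((e (f u) : ℕ) : ℝ) + 1) ≤ ((e (f v) : ℕ) : ℝ) := by exact_mod_cast huv
    have h2 := abs_le.1 (hM u)
    have h3 := abs_le.1 (hM v)
    simp only [p]
    nlinarith
  have hg : ∀ {i u} (hu : f u = i), g u = (E i).pos ⟨u, hu⟩ := by
    rintro i u rfl; rfl
  have hsame : ∀ {u v}, f u = f v → (p u < p v ↔ g u < g v) := by
    intro u v huv; simp [p, huv]
  refine ⟨⟨p, fun u v huv => ?_,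
    fun b u v => ∃ h : f u = f v, (E (f v)).page b ⟨u, h⟩ ⟨v, rfl⟩, fun u v huv hlt => ?_, ?_⟩⟩
  · rcases lt_trichotomy (e (f u)) (e (f v)) with hl | heq | hl
    · exact absurd huv (hlt _ _ hl).ne
    · have heq := e.injective heq
      have : g u = g v := by simpa [p, heq] using huv
      rw [hg heq, hg (u := v) rfl] at this
      exact congrArg Subtype.val ((E (f v)).pos_injective this)
    · exact absurd huv (hlt _ _ hl).ne'
  · have hfuv := hf u v huv
    rw [hsame hfuv, hg hfuv, hg (u := v) rfl] at hlt
    obtain ⟨b, hb⟩ := (E (f v)).exists_page ⟨u, hfuv⟩ ⟨v, rfl⟩ huv hlt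
    exact ⟨b, hfuv, hb⟩
  · rintro b u v x y ⟨huv, hb⟩ ⟨hxy, hb'⟩ ⟨h1, h2, h3⟩
    -- edges of different parts lie over disjoint intervals
    have hvy : f v = f y := by
      rcases lt_trichotomy (e (f v)) (e (f y)) with hl | heq | hl
      · rw [← hxy] at hl
        exact absurd (hlt _ _ hl) h2.not_gt
      · exact e.injective heq
      · exact absurd (hlt _ _ hl) h3.not_gt
    have key : ∀ i (hu : f u = i) (hv : f v = i) (hx : f x = i) (hy : f y = i),
        (E i).page b ⟨u, hu⟩ ⟨v, hv⟩ → (E i).page b ⟨x, hx⟩ ⟨y, hy⟩ → False := by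
      intro i hu hv hx hy hb hb'
      refine (E i).noncrossing b _ _ _ _ hb hb' ⟨?_, ?_, ?_⟩
      · rwa [← hg hu, ← hg hx, ← hsame (hu.trans hx.symm)]
      · rwa [← hg hv, ← hg hx, ← hsame (hx.trans hv.symm)]
      · rwa [← hg hv, ← hg hy, ← hsame (hv.trans hy.symm)]
    have hb2 : (E (f y)).page b ⟨u, huv.trans hvy⟩ ⟨v, hvy⟩ := by
      have : ∀ i (hi : f v = i), (E i).page b ⟨u, huv.trans hi⟩ ⟨v, hi⟩ := by
        rintro i rfl; exact hb
      exact this _ hvy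
    exact key _ _ _ _ _ hb2 hb'

end BookEmbedding

end SimpleGraph

/-! ### Book embeddings of lexicographic products -/

namespace SimpleGraph

variable {V W : Type*} {A : SimpleGraph V}

/-- Among the intervals `[L c, R c]` with `c ∈ S`, the interval of `a` is the smallest one around
the interval of `b`. -/
def IsParent (S : Set V) (L R : V → ℝ) (a b : V) : Prop :=
  L a < L b ∧ R b < R a ∧ ∀ c ∈ S, L c < L b → R b < R c → c = a ∨ L c < L a ∧ R a < R c

/-- The intervals `[L a, R a]` with `a ∈ S` form a laminar family with distinct end points, and
adjacent vertices of `S` have intervals of which one is the parent of the other. -/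
structure IsLaminarOn (A : SimpleGraph V) (S : Set V) (L R : V → ℝ) : Prop where
  lt : ∀ a ∈ S, L a < R a
  laminar : ∀ a ∈ S, ∀ b ∈ S, a ≠ b → R a < L b ∨ R b < L a ∨
    (L a < L b ∧ R b < R a) ∨ (L b < L a ∧ R a < R b)
  adj : ∀ a ∈ S, ∀ b ∈ S, A.Adj a b → IsParent S L R a b ∨ IsParent S L R b a

open Classical in
/-- A vertex without neighbours in `S` receives an interval to the right of all others. -/
theorem IsLaminarOn.insert_isolated {S : Set V} (hS : S.Finite) {L R : V → ℝ}
    (h : A.IsLaminarOn S L R) {b : V} (hb : b ∉ S) (hAb : ∀ a ∈ S, ¬ A.Adj a b) :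
    ∃ L' R' : V → ℝ, A.IsLaminarOn (insert b S) L' R' := by
  obtain ⟨M, hM⟩ := (hS.image R).bddAbove
  have hM : ∀ a ∈ S, R a ≤ M := fun a ha => hM ⟨a, ha, rfl⟩
  have hne : ∀ a ∈ S, a ≠ b := fun a ha hab => hb (hab ▸ ha)
  have hlt := h.lt
  refine ⟨Function.update L b (M + 1), Function.update R b (M + 2), ⟨?_, ?_, ?_⟩⟩
  · rintro a (rfl | ha)
    · simp
    · simpa [hne a ha] using h.lt a ha
  · rintro a (rfl | ha) c (rfl | hc) hac
    · exact absurd rfl hac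
    · have := hM c hc
      simp only [Function.update_self, Function.update_of_ne hac.symm]
      grind
    · have := hM a ha
      simp only [Function.update_self, Function.update_of_ne hac]
      grind
    · simpa [hne a ha, hne c hc] using h.laminar a ha c hc hac
  · have key : ∀ a ∈ S, ∀ c ∈ S, IsParent S L R a c →
        IsParent (insert b S) (Function.update L b (M + 1)) (Function.update R b (M + 2)) a c := by
      rintro a ha c hc ⟨h1, h2, h3⟩
      refine ⟨by simpa [hne a ha, hne c hc] using h1, by simpa [hne a ha, hne c hc] using h2, ?_⟩
      rintro d (rfl | hd)
      · have := hM c hc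
        have := hlt c hc
        simp only [Function.update_self, Function.update_of_ne (hne a ha),
          Function.update_of_ne (hne c hc)]
        grind
      · simpa [hne a ha, hne c hc, hne d hd] using h3 d hd
    rintro a (rfl | ha) c (rfl | hc) hac
    · exact absurd hac (A.irrefl)
    · exact absurd hac.symm (hAb c hc)
    · exact absurd hac (hAb a ha)
    · exact (h.adj a ha c hc hac).imp (key a ha c hc) (key c hc a ha)

open Classical in
/-- A vertex with a single neighbour `p` in `S` receives an interval immediately to the right of
`L p`. -/
theorem IsLaminarOn.insert_leaf {S : Set V} (hS : S.Finite) {L R : V → ℝ}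
    (h : A.IsLaminarOn S L R) {b p : V} (hb : b ∉ S) (hp : p ∈ S)
    (hAb : ∀ a ∈ S, A.Adj a b → a = p) :
    ∃ L' R' : V → ℝ, A.IsLaminarOn (insert b S) L' R' := by
  have hne : ∀ a ∈ S, a ≠ b := fun a ha hab => hb (hab ▸ ha)
  have hlt := h.lt
  have hlam := h.laminar
  obtain ⟨r, hr, hpr⟩ : ∃ r, (∀ a ∈ S, (L a ≤ L p ∨ r < L a) ∧ (R a ≤ L p ∨ r < R a)) ∧ L p < r := by
    have ev : ∀ y : ℝ, ∀ᶠ m in nhdsWithin (L p) (Set.Ioi (L p)), y ≤ L p ∨ m < y := by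
      intro y
      by_cases hy : y ≤ L p
      · simp [hy]
      · filter_upwards [mem_nhdsWithin_of_mem_nhds (Iio_mem_nhds (not_le.1 hy))] with m hm
        exact Or.inr hm
    exact (((hS.eventually_all).2 fun a _ => (ev (L a)).and (ev (R a))).and
      self_mem_nhdsWithin).exists
  obtain ⟨l, hpl, hlr⟩ := exists_between hpr
  have hLp : ∀ a ∈ S, a ≠ p → L a ≠ L p ∧ R a ≠ L p := by
    intro a ha hap
    have := hlam a ha p hp hap
    have := hlt a ha
    have := hlt p hp
    grind
  refine ⟨Function.update L b l, Function.update R b r, ⟨?_, ?_, ?_⟩⟩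
  · rintro a (rfl | ha)
    · simpa
    · simpa [hne a ha] using h.lt a ha
  · have key : ∀ a ∈ S, R a < l ∨ r < L a ∨ (L a < l ∧ r < R a) := by
      intro a ha
      have := hr a ha
      have := hlt a ha
      grind
    rintro a (rfl | ha) c (rfl | hc) hac
    · exact absurd rfl hac
    · have := key c hc
      simp only [Function.update_self, Function.update_of_ne hac.symm]
      grind
    · have := key a ha
      simp only [Function.update_self, Function.update_of_ne hac]
      grind
    · simpa [hne a ha, hne c hc] using h.laminar a ha c hc hac
  · have key : ∀ a ∈ S, ∀ c ∈ S, IsParent S L R a c →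
        IsParent (insert b S) (Function.update L b l) (Function.update R b r) a c := by
      rintro a ha c hc ⟨h1, h2, h3⟩
      refine ⟨by simpa [hne a ha, hne c hc] using h1, by simpa [hne a ha, hne c hc] using h2, ?_⟩
      rintro d (rfl | hd)
      · have := hr c hc
        have := hlt c hc
        simp only [Function.update_self, Function.update_of_ne (hne a ha),
          Function.update_of_ne (hne c hc)]
        grind
      · simpa [hne a ha, hne c hc, hne d hd] using h3 d hd
    have keyp : IsParent (insert b S) (Function.update L b l) (Function.update R b r) p b := by
      have hpR := hr p hp
      have hlp := hlt p hp
      refine ⟨by simpa [hne p hp] using hpl, ?_, ?_⟩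
      · simp only [Function.update_self, Function.update_of_ne (hne p hp)]
        grind
      · rintro d (rfl | hd)
        · simp
        · by_cases hdp : d = p
          · simp [hdp]
          have := hr d hd
          have := hlam d hd p hp hdp
          simp only [Function.update_self, Function.update_of_ne (hne p hp),
            Function.update_of_ne (hne d hd)]
          grind
    rintro a (rfl | ha) c (rfl | hc) hac
    · exact absurd hac (A.irrefl)
    · obtain rfl := hAb c hc hac.symm
      exact Or.inr keyp
    · obtain rfl := hAb a ha hac
      exact Or.inl keyp
    · exact (h.adj a ha c hc hac).imp (key a ha c hc) (key c hc a ha)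

/-- The first vertex of a longest path in a finite acyclic graph has at most one neighbour. -/
theorem IsAcyclic.exists_forall_adj_eq [Finite V] [Nonempty V] (hA : A.IsAcyclic) :
    ∃ v, ∀ a b, A.Adj v a → A.Adj v b → a = b := by
  have ⟨u, v, p, hp, hmax⟩ := Walk.exists_isPath_forall_isPath_length_le_length A
  refine ⟨u, ?_⟩
  have key : ∀ w, A.Adj u w → w = p.snd := by
    intro w hw
    apply hA.eq_snd_of_adj_start hp hw
    have : ¬(p.cons hw.symm).IsPath := by grind [Walk.length_cons]
    grind [hp.cons]
  exact fun a b ha hb => (key a ha).trans (key b hb).symm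

theorem IsAcyclic.exists_isLaminarOn [Finite V] (hA : A.IsAcyclic) :
    ∃ L R : V → ℝ, A.IsLaminarOn Set.univ L R := by
  suffices H : ∀ n, ∀ S : Set V, S.ncard = n → ∃ L R : V → ℝ, A.IsLaminarOn S L R from H _ _ rfl
  intro n
  induction n with
  | zero =>
    intro S hS
    obtain rfl := (Set.ncard_eq_zero S.toFinite).1 hS
    exact ⟨0, 0, by simp, by simp, by simp⟩
  | succ n ih =>
    intro S hS
    have hne : S.Nonempty := Set.nonempty_of_ncard_ne_zero (by omega)
    have := hne.to_subtype
    obtain ⟨⟨b, hb⟩, huniq⟩ := (hA.induce S).exists_forall_adj_eq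
    have hins : insert b (S \ {b}) = S := by simp [Set.insert_eq_of_mem hb]
    obtain ⟨L, R, h⟩ := ih (S \ {b}) (by rw [Set.ncard_sdiff_singleton_of_mem hb, hS]; rfl)
    by_cases hp : ∃ p ∈ S \ {b}, A.Adj p b
    · obtain ⟨p, hpS, hpb⟩ := hp
      have := h.insert_leaf (b := b) (Set.toFinite _) (by simp) hpS fun a ha hab =>
        congrArg Subtype.val (huniq ⟨a, ha.1⟩ ⟨p, hpS.1⟩ hab.symm hpb.symm)
      rwa [hins] at this
    · have := h.insert_isolated (b := b) (Set.toFinite _) (by simp) fun a ha hab => hp ⟨a, ha, hab⟩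
      rwa [hins] at this

/-- In a laminar representation of a forest `A`, the two copies of a vertex are placed at the ends
of its interval. The edges at the left end of an interval, towards its right end and its children,
go on one page, and the edges at the right end towards the children on the other. -/
theorem IsAcyclic.nonempty_bookEmbedding_lexProd_top [Finite V] (hA : A.IsAcyclic) :
    Nonempty (A.lexProd (⊤ : SimpleGraph (Fin 2))).BookEmbedding := by
  obtain ⟨L, R, h⟩ := hA.exists_isLaminarOn
  have hlt := fun a => h.lt a trivial
  have hlam := fun a b => h.laminar a trivial b trivial
  have hadj := fun a b => h.adj a trivial b trivial
  let pos : V × Fin 2 → ℝ := fun v => if v.2 = 0 then L v.1 else R v.1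
  let page : Bool → V × Fin 2 → V × Fin 2 → Prop := fun b u v =>
    if b then u.2 = 0 ∧ (u.1 = v.1 ∧ v.2 = 1 ∨ IsParent Set.univ L R u.1 v.1)
    else v.2 = 1 ∧ IsParent Set.univ L R v.1 u.1
  have two : ∀ i : Fin 2, i = 0 ∨ i = 1 := by decide
  refine ⟨⟨pos, ?_, page, ?_, ?_⟩⟩
  · rintro ⟨a, i⟩ ⟨b, j⟩ hab
    have h1 := hlam a b
    have h2 := hlt a
    have h3 := hlt b
    rcases two i with rfl | rfl <;> rcases two j with rfl | rfl <;> simp [pos] at hab ⊢ <;> grind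
  · rintro ⟨a, i⟩ ⟨b, j⟩ hab hlt'
    have h2 := hlt a
    have h3 := hlt b
    rcases hab with ⟨rfl, hij⟩ | hab
    · have hij : i ≠ j := hij
      exact ⟨true, by rcases two i with rfl | rfl <;> rcases two j with rfl | rfl <;>
        simp [pos, page] at hij hlt' ⊢; grind⟩
    · rcases hadj a b hab with hP | hP
      · have := hP.1
        have := hP.2.1
        refine ⟨true, ?_⟩
        rcases two i with rfl | rfl
        · simp [page, hP]
        · rcases two j with rfl | rfl <;> simp [pos] at hlt' <;> grind
      · have := hP.1
        have := hP.2.1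
        refine ⟨false, ?_⟩
        rcases two j with rfl | rfl
        · rcases two i with rfl | rfl <;> simp [pos] at hlt' <;> grind
        · simp [page, hP]
  · have pos0 : ∀ a, pos (a, 0) = L a := fun a => rfl
    have pos1 : ∀ a, pos (a, 1) = R a := fun a => rfl
    have bounds : ∀ a i, L a ≤ pos (a, i) ∧ pos (a, i) ≤ R a := by
      intro a i
      have := hlt a
      rcases two i with rfl | rfl
      · exact ⟨le_rfl, this.le⟩
      · exact ⟨this.le, le_rfl⟩
    rintro (_ | _) ⟨u, i⟩ ⟨v, j⟩ ⟨x, k⟩ ⟨y, l⟩ huv hxy ⟨hux, hxv, hvy⟩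
    · simp only [page, Bool.false_eq_true, if_false] at huv hxy
      obtain ⟨rfl, hvu⟩ := huv
      obtain ⟨rfl, hyx⟩ := hxy
      have := bounds u i
      have := bounds x k
      have h1 := hlam v y
      have h2 := hlam x v
      have h3 := hyx.2.2 v trivial
      have := hvu.1
      have := hyx.1
      have := hlt v
      have := hlt x
      rw [pos1] at hxv hvy
      rw [pos1] at hvy
      rcases two k with rfl | rfl <;> simp only [pos0, pos1] at * <;> grind
    · simp only [page, if_true] at huv hxy
      obtain ⟨rfl, huv⟩ := huv
      obtain ⟨rfl, hxy⟩ := hxy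
      have hyR : pos (y, l) ≤ R x := by
        rcases hxy with ⟨rfl, rfl⟩ | hxy
        · exact le_rfl
        · exact (bounds y l).2.trans hxy.2.1.le
      rw [pos0] at hux hxv
      rw [pos0] at hux
      have h1 := hlam u x
      rcases huv with ⟨rfl, rfl⟩ | huv
      · rw [pos1] at hxv hvy
        grind
      · have := bounds v j
        have h2 := hlam x v
        have h3 := huv.2.2 x trivial
        have := huv.2.1
        have := hlt v
        have := hlt x
        rcases two j with rfl | rfl <;> simp only [pos0, pos1] at * <;> grind

theorem nonempty_bookEmbedding_octahedron :
    Nonempty ((⊤ : SimpleGraph (Fin 3)).lexProd (⊤ : SimpleGraph (Fin 2))ᶜ).BookEmbedding := by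
  let G := (⊤ : SimpleGraph (Fin 3)).lexProd (⊤ : SimpleGraph (Fin 2))ᶜ
  -- The positions `0, …, 5` list a hexagon in which antipodal vertices are opposite. The triangle
  -- on the odd positions goes on one page, and all other edges on the other.
  let pos : Fin 3 × Fin 2 → ℕ := fun v => v.1 + 3 * v.2
  let page : Bool → Fin 3 × Fin 2 → Fin 3 × Fin 2 → Prop := fun b u v =>
    u.1 ≠ v.1 ∧ (b = true ↔ pos u % 2 = 1 ∧ pos v % 2 = 1)
  refine ⟨⟨fun v => pos v, ?_, page, ?_, ?_⟩⟩
  · have : Function.Injective pos := by decide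
    exact Nat.cast_injective.comp this
  · rintro u v h -
    refine ⟨decide (pos u % 2 = 1 ∧ pos v % 2 = 1), ?_, by simp⟩
    rcases h with ⟨-, h⟩ | h
    · simp at h
    · exact h
  · simp only [Nat.cast_lt]
    rintro b ⟨u, i⟩ ⟨v, j⟩ ⟨x, k⟩ ⟨y, l⟩ h1 h2 h3
    simp only [page, pos] at h1 h2 h3
    have two : ∀ i : Fin 2, i = 0 ∨ i = 1 := by decide
    cases b <;> simp [Fin.ext_iff] at h1 h2 <;> rcases two i with rfl | rfl <;>
      rcases two j with rfl | rfl <;> rcases two k with rfl | rfl <;>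
      rcases two l with rfl | rfl <;> simp at h1 h2 h3 <;> omega

/-- The homomorphism between lexicographic products induced by homomorphisms of the factors. -/
def lexProdMap {V' W' : Type*} {A : SimpleGraph V} {A' : SimpleGraph V'} {B : SimpleGraph W}
    {B' : SimpleGraph W'} (f : A →g A') (g : B →g B') : A.lexProd B →g A'.lexProd B' where
  toFun := Prod.map f g
  map_rel' h := h.imp (fun h => ⟨congrArg f h.1, g.map_adj h.2⟩) f.map_adj

theorem nonempty_bookEmbedding_lexProd_of_components [Finite V] [Finite W] {B : SimpleGraph W}
    (h : ∀ C : A.ConnectedComponent, Nonempty (C.toSimpleGraph.lexProd B).BookEmbedding) :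
    Nonempty (A.lexProd B).BookEmbedding := by
  refine BookEmbedding.nonempty_of_fibers (fun p => A.connectedComponentMk p.1) ?_ fun C => ?_
  · rintro ⟨a, b⟩ ⟨a', b'⟩ (⟨h, -⟩ | h)
    · exact congrArg _ h
    · exact ConnectedComponent.sound h.reachable
  · obtain ⟨E⟩ := h C
    refine ⟨E.comap ⟨fun p => (⟨p.1.1, p.2⟩, p.1.2), ?_⟩ ?_⟩
    · rintro ⟨⟨a, b⟩, ha⟩ ⟨⟨a', b'⟩, ha'⟩ (⟨h, h'⟩ | h)
      · exact Or.inl ⟨Subtype.ext h, h'⟩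
      · exact Or.inr h
    · rintro ⟨⟨a, b⟩, ha⟩ ⟨⟨a', b'⟩, ha'⟩ h
      have h₁ := congrArg (fun q => (q.1 : V)) h
      have h₂ := congrArg Prod.snd h
      exact Subtype.ext (Prod.ext h₁ h₂)

end SimpleGraph

/-! ### Planar and polyhedral lexicographic products -/

namespace SimpleGraph

variable {V W : Type*} {A : SimpleGraph V} {B : SimpleGraph W}

theorem lexProdMap_injective {V' W' : Type*} {A' : SimpleGraph V'} {B' : SimpleGraph W'}
    (f : A →g A') (g : B →g B') (hf : Function.Injective f) (hg : Function.Injective g) :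
    Function.Injective (lexProdMap f g) :=
  hf.prodMap hg

theorem card_le_two_of_isPlanar_lexProd [Finite W] (h : (A.lexProd B).IsPlanar) {a b : V}
    (hab : A.Adj a b) : Nat.card W ≤ 2 := by
  by_contra! hW
  obtain ⟨e⟩ : Nonempty (Fin 3 ↪ W) := by
    have := Fintype.ofFinite W
    rw [Nat.card_eq_fintype_card] at hW
    exact Function.Embedding.nonempty_of_card_le (by simpa using Nat.succ_le_of_lt hW)
  exact h.not_forall_adj (fun i => (a, e i)) (fun j => (b, e j))
    (fun i j hij => e.injective (Prod.ext_iff.1 hij).2)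
    (fun i j hij => e.injective (Prod.ext_iff.1 hij).2) fun i j => Or.inr hab

theorem nonempty_iso_of_card_eq_two (hW : Nat.card W = 2) :
    Nonempty (B ≃g (⊤ : SimpleGraph (Fin 2))ᶜ) ∨ Nonempty (B ≃g (⊤ : SimpleGraph (Fin 2))) := by
  have : Finite W := Nat.finite_of_card_ne_zero (by omega)
  let e : W ≃ Fin 2 := Finite.equivFinOfCardEq hW
  have two : ∀ i : Fin 2, i = 0 ∨ i = 1 := by decide
  have hw : ∀ w, w = e.symm 0 ∨ w = e.symm 1 := fun w => by
    simpa only [Equiv.eq_symm_apply] using two (e w)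
  by_cases h : B.Adj (e.symm 0) (e.symm 1)
  · refine Or.inr ⟨⟨e, fun {a b} => ?_⟩⟩
    rcases hw a with rfl | rfl <;> rcases hw b with rfl | rfl <;> simp [h, h.symm]
  · refine Or.inl ⟨⟨e, fun {a b} => ?_⟩⟩
    have h' : ¬ B.Adj (e.symm 1) (e.symm 0) := fun h' => h h'.symm
    rcases hw a with rfl | rfl <;> rcases hw b with rfl | rfl <;> simp [h, h']

/-- Here `A ∘ B` contains `K₃,₃`, since already six vertices of it are pairwise adjacent. -/
theorem not_isPlanar_lexProd_of_triangle_of_adj {u v w : V} (huv : A.Adj u v) (huw : A.Adj u w)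
    (hvw : A.Adj v w) {b c : W} (hbc : B.Adj b c) : ¬ (A.lexProd B).IsPlanar := by
  intro h
  have n1 := huv.ne
  have n2 := huw.ne
  have n3 := hvw.ne
  have n4 := hbc.ne
  refine h.not_forall_adj ![(u, b), (u, c), (v, b)] ![(v, c), (w, b), (w, c)] ?_ ?_ ?_
  · intro i j
    fin_cases i <;> fin_cases j <;> simp [n1, n1.symm, n4, n4.symm]
  · intro i j
    fin_cases i <;> fin_cases j <;> simp [n3, n3.symm, n4, n4.symm]
  · intro i j
    fin_cases i <;> fin_cases j <;> simp [lexProd, huv, huw, hvw, hbc]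

/-- In a connected graph, some edge leads out of any set of vertices that is neither empty nor
everything. -/
theorem Connected.exists_adj_mem_notMem (hA : A.Connected) (T : Set V) {u v : V} (hu : u ∈ T)
    (hv : v ∉ T) : ∃ x ∈ T, ∃ y ∉ T, A.Adj x y := by
  obtain ⟨p⟩ := hA.preconnected u v
  obtain ⟨d, -, h1, h2⟩ := p.exists_boundary_dart T hu hv
  exact ⟨_, h1, _, h2, d.adj⟩

theorem Connected.nonempty_iso_or_isTree_of_isPlanar_lexProd [Nontrivial W] (hA : A.Connected)
    (h : (A.lexProd B).IsPlanar) : Nonempty (A ≃g (⊤ : SimpleGraph (Fin 3))) ∨ A.IsTree := by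
  obtain ⟨b, c, hbc⟩ := exists_pair_ne W
  by_cases hac : A.IsAcyclic
  · exact Or.inr ⟨hA, hac⟩
  refine Or.inl ?_
  simp only [IsAcyclic, not_forall, not_not] at hac
  obtain ⟨v₀, p, hp⟩ := hac
  match v₀, p, hp with
  | _, .nil, hp => exact absurd rfl hp.ne_nil
  | _, .cons h₀₁ .nil, hp => exact absurd h₀₁ A.irrefl
  | _, .cons h₀₁ (.cons h₁₂ .nil), hp => simp [Walk.cons_isCycle_iff] at hp
  | v₀, .cons (v := v₁) h₀₁ (.cons (v := v₂) h₁₂ (.cons (v := v₃) h₂₃ q)), hp =>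
    have hp' := ((Walk.cons_isCycle_iff _ _).1 hp).1
    simp only [Walk.cons_isPath_iff, Walk.support_cons, List.mem_cons, not_or] at hp'
    obtain ⟨⟨-, hq₂⟩, -, hq₁⟩ := hp'
    have h₀₂ : v₀ ≠ v₂ := fun h => hq₂ (h ▸ q.end_mem_support)
    by_cases h₃₀ : v₃ = v₀
    · subst h₃₀
      have cover : ∀ x, x = v₃ ∨ x = v₁ ∨ x = v₂ := by
        by_contra! hx
        obtain ⟨x, hx⟩ := hx
        obtain ⟨u, hu, y, hy, huy⟩ := hA.exists_adj_mem_notMem {v₃, v₁, v₂}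
          (u := v₃) (v := x) (by simp) (by simpa using hx)
        simp only [Set.mem_insert_iff, Set.mem_singleton_iff, not_or] at hu hy
        obtain ⟨y0, y1, y2⟩ := hy
        rcases hu with rfl | rfl | rfl
        · exact not_isPlanar_lexProd_of_triangle hbc h₀₁ h₂₃.symm h₁₂ huy y1 y2 h
        · exact not_isPlanar_lexProd_of_triangle hbc h₀₁.symm h₁₂ h₂₃.symm huy y0 y2 h
        · exact not_isPlanar_lexProd_of_triangle hbc h₂₃ h₁₂.symm h₀₁ huy y0 y1 h
      let e : Fin 3 ≃ V := Equiv.ofBijective ![v₃, v₁, v₂] ⟨?_, ?_⟩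
      · refine ⟨RelIso.symm ⟨e, fun {i j} => ?_⟩⟩
        change A.Adj (![v₃, v₁, v₂] i) (![v₃, v₁, v₂] j) ↔ _
        fin_cases i <;> fin_cases j <;>
          simp [h₀₁, h₁₂, h₂₃, h₀₁.symm, h₁₂.symm, h₂₃.symm]
      · have n1 := h₀₁.ne
        have n2 := h₁₂.ne
        have n3 := h₂₃.ne
        intro i j
        fin_cases i <;> fin_cases j <;> simp [n1, n2, n3, n1.symm, n2.symm, n3.symm]
      · intro x
        rcases cover x with rfl | rfl | rfl
        exacts [⟨0, rfl⟩, ⟨1, rfl⟩, ⟨2, rfl⟩]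
    · exact absurd h (not_isPlanar_lexProd_of_walk hbc h₀₁ h₁₂ h₂₃ h₀₂ h₃₀ q hq₁ hq₂)

theorem not_isPlanar_lexProd_of_iso (e : A ≃g (⊤ : SimpleGraph (Fin 3)))
    (f : B ≃g (⊤ : SimpleGraph (Fin 2))) : ¬ (A.lexProd B).IsPlanar := by
  have he : ∀ {i j : Fin 3}, i ≠ j → A.Adj (e.symm i) (e.symm j) := fun h =>
    e.symm.map_adj_iff.2 h
  exact not_isPlanar_lexProd_of_triangle_of_adj (he (i := 0) (j := 1) (by decide))
    (he (j := 2) (by decide)) (he (by decide))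
    (f.symm.map_adj_iff.2 (show (0 : Fin 2) ≠ 1 by decide))

theorem isPlanar_lexProd_iff [Finite V] [Finite W] [Nontrivial W] (hA : A.edgeSet.Nonempty) :
    (A.lexProd B).IsPlanar ↔
      (Nonempty (B ≃g (⊤ : SimpleGraph (Fin 2))ᶜ) ∧
        ∀ C : A.ConnectedComponent,
          Nonempty (C.toSimpleGraph ≃g (⊤ : SimpleGraph (Fin 3))) ∨ C.toSimpleGraph.IsTree) ∨
      (Nonempty (B ≃g (⊤ : SimpleGraph (Fin 2))) ∧
        ∀ C : A.ConnectedComponent, C.toSimpleGraph.IsTree) := by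
  constructor
  · intro h
    obtain ⟨e, he⟩ := hA
    induction e with | _ a b
    have hW : Nat.card W = 2 :=
      (card_le_two_of_isPlanar_lexProd h he).antisymm Finite.one_lt_card
    have hC : ∀ C : A.ConnectedComponent, (C.toSimpleGraph.lexProd B).IsPlanar := fun C =>
      h.of_hom (lexProdMap C.toSimpleGraph_hom Hom.id)
        (lexProdMap_injective _ _ Subtype.val_injective Function.injective_id)
    have hC' := fun C : A.ConnectedComponent =>
      C.connected_toSimpleGraph.nonempty_iso_or_isTree_of_isPlanar_lexProd (hC C)
    rcases nonempty_iso_of_card_eq_two (B := B) hW with hB | hB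
    · exact Or.inl ⟨hB, hC'⟩
    · refine Or.inr ⟨hB, fun C => (hC' C).resolve_left ?_⟩
      rintro ⟨e⟩
      exact not_isPlanar_lexProd_of_iso e hB.some (hC C)
  · intro h
    suffices H : ∀ C : A.ConnectedComponent, Nonempty (C.toSimpleGraph.lexProd B).BookEmbedding from
      (nonempty_bookEmbedding_lexProd_of_components H).some.isPlanar
    intro C
    rcases h with ⟨⟨f⟩, hC⟩ | ⟨⟨f⟩, hC⟩
    · rcases hC C with ⟨⟨e⟩⟩ | hT
      · obtain ⟨E⟩ := nonempty_bookEmbedding_octahedron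
        exact ⟨E.comap (lexProdMap e.toHom f.toHom)
          (lexProdMap_injective _ _ e.injective f.injective)⟩
      · obtain ⟨E⟩ := hT.isAcyclic.nonempty_bookEmbedding_lexProd_top
        refine ⟨E.comap (lexProdMap Hom.id ⟨f, fun h => ?_⟩)
          (lexProdMap_injective _ _ Function.injective_id f.injective)⟩
        exact fun h' => h.ne (f.injective h')
    · obtain ⟨E⟩ := (hC C).isAcyclic.nonempty_bookEmbedding_lexProd_top
      exact ⟨E.comap (lexProdMap Hom.id f.toHom)
        (lexProdMap_injective _ _ Function.injective_id f.injective)⟩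

theorem IsVertexConnected.of_iso {G : SimpleGraph V} {H : SimpleGraph W} {k : ℕ} (e : G ≃g H)
    (h : G.IsVertexConnected k) : H.IsVertexConnected k := by
  refine ⟨by rw [← ENat.card_congr e.toEquiv]; exact h.1, fun S hS => ?_⟩
  have hc := h.2 (S.map e.symm.toEquiv.toEmbedding) (by simpa using hS)
  refine (Iso.connected_iff ⟨e.toEquiv.subtypeEquiv fun v => ?_, ?_⟩).1 hc
  · simp only [Set.mem_ofPred_eq, Finset.mem_map_equiv]
    rfl
  · intro a b
    exact e.map_adj_iff

/-- A graph is `k`-connected if it has more than `k` vertices and any two non-adjacent vertices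
have at least `k` common neighbours. -/
theorem isVertexConnected_of_le_card [Fintype V] [DecidableEq V] {G : SimpleGraph V}
    [DecidableRel G.Adj] {k : ℕ} (hk : k < Fintype.card V)
    (h : ∀ u v, u ≠ v → ¬ G.Adj u v →
      k ≤ (Finset.univ.filter fun w => G.Adj u w ∧ G.Adj w v).card) : G.IsVertexConnected k := by
  refine ⟨by rw [ENat.card_eq_coe_fintype_card]; exact_mod_cast hk, fun S hS => ?_⟩
  have : Nonempty {v : V | v ∉ S} := by
    obtain ⟨v, -, hv⟩ := Finset.exists_mem_notMem_of_card_lt_card (s := S) (t := Finset.univ)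
      (hS.trans hk)
    exact ⟨⟨v, hv⟩⟩
  refine ⟨?_⟩
  rintro ⟨u, hu⟩ ⟨v, hv⟩
  by_cases huv : u = v
  · subst huv; rfl
  by_cases hadj : G.Adj u v
  · exact Adj.reachable (G := G.induce {v : V | v ∉ S}) hadj
  · obtain ⟨w, hw, hwS⟩ := Finset.exists_mem_notMem_of_card_lt_card (hS.trans_le (h u v huv hadj))
    simp only [Finset.mem_filter, Finset.mem_univ, true_and] at hw
    have h₁ : (G.induce {v : V | v ∉ S}).Adj ⟨u, hu⟩ ⟨w, hwS⟩ := hw.1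
    have h₂ : (G.induce {v : V | v ∉ S}).Adj ⟨w, hwS⟩ ⟨v, hv⟩ := hw.2
    exact h₁.reachable.trans h₂.reachable

theorem IsVertexConnected.exists_adj_mem_notMem {G : SimpleGraph V} {k : ℕ}
    (h : G.IsVertexConnected k) (S : Finset V) (hS : S.card < k) (T : Set V) {u v : V} (hu : u ∈ T)
    (huS : u ∉ S) (hv : v ∉ T) (hvS : v ∉ S) : ∃ x ∈ T, ∃ y ∉ T, y ∉ S ∧ G.Adj x y := by
  obtain ⟨x, hx, y, hy, hxy⟩ := (h.2 S hS).exists_adj_mem_notMem (Subtype.val ⁻¹' T)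
    (u := ⟨u, huS⟩) (v := ⟨v, hvS⟩) hu hv
  exact ⟨x, hx, y, hy, y.2, hxy⟩

instance [DecidableEq V] [DecidableRel A.Adj] [DecidableRel B.Adj] :
    DecidableRel (A.lexProd B).Adj :=
  fun p q => inferInstanceAs (Decidable ((p.1 = q.1 ∧ B.Adj p.2 q.2) ∨ A.Adj p.1 q.1))

instance : DecidableRel octahedronGraph.Adj :=
  fun p q => inferInstanceAs (Decidable (p ≠ q ∧ q ≠ (p.1, -p.2)))

/-- The isomorphism between lexicographic products induced by isomorphisms of the factors. -/
def lexProdCongr {V' W' : Type*} {A' : SimpleGraph V'} {B' : SimpleGraph W'}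
    (e : A ≃g A') (f : B ≃g B') : A.lexProd B ≃g A'.lexProd B' where
  toEquiv := e.toEquiv.prodCongr f.toEquiv
  map_rel_iff' {p q} := by
    change (e p.1 = e q.1 ∧ B'.Adj (f p.2) (f q.2)) ∨ A'.Adj (e p.1) (e q.1) ↔
      (p.1 = q.1 ∧ B.Adj p.2 q.2) ∨ A.Adj p.1 q.1
    rw [e.injective.eq_iff, f.map_adj_iff, e.map_adj_iff]

/-- If `w` is the only neighbour of `v` in `A`, removing the two copies of `w` from `A ∘ B`
separates the copies of `v` from all other vertices, and from each other if `B` has no edge. -/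
theorem IsTree.nonempty_iso_of_isVertexConnected_lexProd [Finite V] [Finite W] (hA : A.IsTree)
    {a a' : V} (haa : A.Adj a a') (hW : Nat.card W = 2) (h : (A.lexProd B).IsVertexConnected 3) :
    Nonempty (A ≃g (⊤ : SimpleGraph (Fin 2))) ∧ Nonempty (B ≃g (⊤ : SimpleGraph (Fin 2))) := by
  have := hA.connected.nonempty
  have := Fintype.ofFinite W
  obtain ⟨v, hv⟩ := hA.isAcyclic.exists_forall_adj_eq
  obtain ⟨z, hzv⟩ : ∃ z, z ≠ v := by
    by_cases hav : a = v
    · exact ⟨a', fun h => haa.ne (hav.trans h.symm)⟩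
    · exact ⟨a, hav⟩
  obtain ⟨v', hv', w, -, hvw⟩ := hA.connected.exists_adj_mem_notMem {v} rfl hzv
  obtain rfl : v = v' := hv'.symm
  have hw : ∀ x, A.Adj v x → x = w := fun x hx => hv x w hx hvw
  let S : Finset (V × W) := Finset.univ.map (Function.Embedding.sectR w W)
  have hS : S.card < 3 := by
    rw [Finset.card_map, Finset.card_univ, ← Nat.card_eq_fintype_card, hW]; norm_num
  have memS : ∀ p : V × W, p ∈ S ↔ p.1 = w := by
    rintro ⟨x, b⟩
    simp [S, eq_comm]
  have cover : ∀ x, x = v ∨ x = w := by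
    by_contra! hx
    obtain ⟨x, hxv, hxw⟩ := hx
    obtain ⟨b⟩ : Nonempty W := (Nat.card_pos_iff.1 (by omega)).1
    obtain ⟨p, hp, q, hq, hqS, hpq⟩ := h.exists_adj_mem_notMem S hS {p | p.1 = v}
      (u := (v, b)) (v := (x, b)) rfl (by simpa [memS] using hvw.ne) hxv (by simpa [memS] using hxw)
    rcases hpq with ⟨hpq, -⟩ | hpq
    · exact hq (hpq.symm.trans hp)
    · have hp : p.1 = v := hp
      exact hqS ((memS q).2 (hw _ (hp ▸ hpq)))
  refine ⟨?_, (nonempty_iso_of_card_eq_two hW).resolve_left ?_⟩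
  · let e : Fin 2 ≃ V := Equiv.ofBijective ![v, w] ⟨?_, ?_⟩
    · refine ⟨RelIso.symm ⟨e, fun {i j} => ?_⟩⟩
      change A.Adj (![v, w] i) (![v, w] j) ↔ _
      fin_cases i <;> fin_cases j <;> simp [hvw, hvw.symm]
    · intro i j
      fin_cases i <;> fin_cases j <;> simp [hvw.ne, hvw.ne.symm]
    · intro x
      rcases cover x with rfl | rfl
      exacts [⟨0, rfl⟩, ⟨1, rfl⟩]
  · rintro ⟨f⟩
    have hB : ∀ b c, ¬ B.Adj b c := fun b c hbc => by
      have := f.map_adj_iff.2 hbc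
      simp at this
    obtain ⟨p, hp, q, hq, hqS, hpq⟩ := h.exists_adj_mem_notMem S hS {(v, f.symm 0)}
      (u := (v, f.symm 0)) (v := (v, f.symm 1)) rfl (by simpa [memS] using hvw.ne)
      (by simp) (by simpa [memS] using hvw.ne)
    rw [Set.mem_singleton_iff] at hp
    subst hp
    rcases hpq with ⟨-, hpq⟩ | hpq
    · exact hB _ _ hpq
    · exact hqS ((memS q).2 (hw _ hpq))

theorem IsVertexConnected.connected_of_lexProd [Nonempty W] {k : ℕ} (hk : 0 < k)
    (h : (A.lexProd B).IsVertexConnected k) : A.Connected := by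
  obtain ⟨b⟩ := ‹Nonempty W›
  have : Nonempty V := by
    obtain ⟨p⟩ := (h.2 ∅ (by simpa using hk)).nonempty
    exact ⟨p.1.1⟩
  refine ⟨fun u v => ?_⟩
  by_contra huv
  obtain ⟨p, hp, q, hq, -, hpq⟩ := h.exists_adj_mem_notMem ∅ (by simpa using hk)
    {p | A.Reachable u p.1} (u := (u, b)) (v := (v, b)) (Reachable.refl u) (by simp) huv (by simp)
  rcases hpq with ⟨hpq, -⟩ | hpq
  · exact hq (show A.Reachable u q.1 from hpq ▸ hp)
  · exact hq (Reachable.trans hp hpq.reachable)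

theorem isPolyhedral_lexProd_iff [Finite V] [Finite W] [Nontrivial W]
    (hA : A.edgeSet.Nonempty) : (A.lexProd B).IsPolyhedral ↔
      (Nonempty (A ≃g (⊤ : SimpleGraph (Fin 2))) ∧ Nonempty (B ≃g (⊤ : SimpleGraph (Fin 2)))) ∨
      (Nonempty (A ≃g (⊤ : SimpleGraph (Fin 3))) ∧ Nonempty (B ≃g (⊤ : SimpleGraph (Fin 2))ᶜ)) := by
  constructor
  · rintro ⟨hpl, hconn⟩
    obtain ⟨e, he⟩ := hA
    induction e with | _ a b
    have hW : Nat.card W = 2 :=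
      (card_le_two_of_isPlanar_lexProd hpl he).antisymm Finite.one_lt_card
    have hAc : A.Connected := hconn.connected_of_lexProd (by norm_num)
    rcases hAc.nonempty_iso_or_isTree_of_isPlanar_lexProd hpl with ⟨⟨e⟩⟩ | hT
    · refine Or.inr ⟨⟨e⟩, (nonempty_iso_of_card_eq_two hW).resolve_right ?_⟩
      rintro ⟨f⟩
      exact not_isPlanar_lexProd_of_iso e f hpl
    · exact Or.inl (hT.nonempty_iso_of_isVertexConnected_lexProd he hW hconn)
  · rintro (⟨⟨e⟩, ⟨f⟩⟩ | ⟨⟨e⟩, ⟨f⟩⟩)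
    · constructor
      · obtain ⟨E⟩ := (IsAcyclic.of_card_le_two
          (G := (⊤ : SimpleGraph (Fin 2))) (by simp)).nonempty_bookEmbedding_lexProd_top
        exact (E.comap (lexProdCongr e f).toHom (lexProdCongr e f).injective).isPlanar
      · refine IsVertexConnected.of_iso (lexProdCongr e f).symm
          (isVertexConnected_of_le_card (by decide) (by decide))
    · constructor
      · obtain ⟨E⟩ := nonempty_bookEmbedding_octahedron
        exact (E.comap (lexProdCongr e f).toHom (lexProdCongr e f).injective).isPlanar
      · refine IsVertexConnected.of_iso (lexProdCongr e f).symm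
          (isVertexConnected_of_le_card (by decide) (by decide))

theorem nonempty_lexProd_iso_top : Nonempty ((⊤ : SimpleGraph (Fin 2)).lexProd
    (⊤ : SimpleGraph (Fin 2)) ≃g (⊤ : SimpleGraph (Fin 4))) := by
  refine ⟨⟨(finProdFinEquiv : Fin 2 × Fin 2 ≃ Fin (2 * 2)), fun {p q} => ?_⟩⟩
  revert p q
  decide

theorem nonempty_lexProd_iso_octahedronGraph : Nonempty ((⊤ : SimpleGraph (Fin 3)).lexProd
    (⊤ : SimpleGraph (Fin 2))ᶜ ≃g octahedronGraph) := by
  let f : Fin 2 ≃ ℤˣ := ⟨![1, -1], fun u => if u = 1 then 0 else 1, by decide, by decide⟩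
  refine ⟨⟨(Equiv.refl (Fin 3)).prodCongr f, fun {p q} => ?_⟩⟩
  revert p q
  decide

end SimpleGraph

theorem mainTheorem5 {V W : Type*} [Finite V] [Finite W] [Nontrivial W]
    (A : SimpleGraph V) (B : SimpleGraph W) (hA : A.edgeSet.Nonempty) :
    ((A.lexProd B).IsPlanar ↔
      (Nonempty (B ≃g (⊤ : SimpleGraph (Fin 2))ᶜ) ∧
        ∀ C : A.ConnectedComponent,
          Nonempty (C.toSimpleGraph ≃g (⊤ : SimpleGraph (Fin 3))) ∨ C.toSimpleGraph.IsTree) ∨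
      (Nonempty (B ≃g (⊤ : SimpleGraph (Fin 2))) ∧
        ∀ C : A.ConnectedComponent, C.toSimpleGraph.IsTree)) ∧
    ((A.lexProd B).IsPolyhedral ↔
      (Nonempty (A ≃g (⊤ : SimpleGraph (Fin 2))) ∧ Nonempty (B ≃g (⊤ : SimpleGraph (Fin 2)))) ∨
      (Nonempty (A ≃g (⊤ : SimpleGraph (Fin 3))) ∧ Nonempty (B ≃g (⊤ : SimpleGraph (Fin 2))ᶜ))) ∧
    Nonempty ((⊤ : SimpleGraph (Fin 2)).lexProd (⊤ : SimpleGraph (Fin 2)) ≃g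
      (⊤ : SimpleGraph (Fin 4))) ∧
    Nonempty ((⊤ : SimpleGraph (Fin 3)).lexProd (⊤ : SimpleGraph (Fin 2))ᶜ ≃g
      SimpleGraph.octahedronGraph) :=
  ⟨SimpleGraph.isPlanar_lexProd_iff hA, SimpleGraph.isPolyhedral_lexProd_iff hA,
    SimpleGraph.nonempty_lexProd_iso_top, SimpleGraph.nonempty_lexProd_iso_octahedronGraph⟩
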